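/- Let $k$ be a field of characteristic not $2$, and let $B$ be a finite-dimensional central division $k$-algebra with an involution $\tau$ (an additive map $\tau:B\to B$ with $\tau(xy)=\tau(y)\tau(x)$ and $\tau(\tau(x))=x$) that is unitary, i.e. not the identity on $k$. Let $k_0=\{c\in k : \tau(c)=c\}$, so that $k/k_0$ is a quadratic extension, and let $d\in k_0$ be such that $k=k_0(\sqrt{-d})$. Put $\mathrm{Sym}(B,\tau)=\{x\in B : \tau(x)=x\}$. Let $L_0$ be a subfield of $B$ with $k_0\subseteq L_0\subseteq \mathrm{Sym}(B,\tau)$ that is maximal (with respect to inclusion) among such subfields, and let $L_0(\sqrt{-d})\subseteq B$ be the subfield generated by $L_0$ and $\sqrt{-d}$. Assume that the extension $L_0(\sqrt{-d})/k$ is Galois. Suppose that there is an ordering $P$ of the field $k_0$ at which $\tau$ is positive, meaning that the involution trace form $x\mapsto \mathrm{Trd}_B(\tau(x)x)$ (which takes values in $k_0$, where $\mathrm{Trd}_B$ is the reduced trace of $B$) is positive definite with respect to $P$: for every nonzero $x\in B$, $\mathrm{Trd}_B(\tau(x)x)$ is strictly positive at $P$. Then $L_0/k_0$ is a Galois extension.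 -/

import Mathlib

open scoped TensorProduct

namespace DivisionAlgebraWithInvolution

section Splitting

/-- For a central division `k`-algebra `B` and a field extension `K/k`, the ring `B ⊗[k] K` is
simple. -/
theorem isSimpleRing_tensor (k B K : Type*) [Field k] [DivisionRing B] [Algebra k B]
    [Algebra.IsCentral k B] [Field K] [Algebra k K] : IsSimpleRing (B ⊗[k] K) := by
  classical
  let e := Module.Basis.ofVectorSpace k K
  let E := Algebra.TensorProduct.basis B e
  have hE : ∀ i, E i = (1 : B) ⊗ₜ[k] e i := fun i => Algebra.TensorProduct.basis_apply e i
  have hnt : Nontrivial (B ⊗[k] K) := inferInstance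
  -- left and right multiplication by elements of `B`
  have hL : ∀ (b : B) (t : B ⊗[k] K) i, E.repr ((b ⊗ₜ[k] (1 : K)) * t) i = b * E.repr t i := by
    intro b t i
    have : (b ⊗ₜ[k] (1 : K)) * t = b • t := by
      induction t with
      | zero => simp
      | tmul x y => simp [TensorProduct.smul_tmul']
      | add x y hx hy => rw [mul_add, smul_add, hx, hy]
    rw [this]; simp
  have hR : ∀ (b : B) (t : B ⊗[k] K) i, E.repr (t * (b ⊗ₜ[k] (1 : K))) i = E.repr t i * b := by
    intro b t i
    induction t with
    | zero => simp
    | tmul x y =>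
      simp only [Algebra.TensorProduct.tmul_mul_tmul, mul_one]
      rw [Algebra.TensorProduct.basis_repr_tmul, Algebra.TensorProduct.basis_repr_tmul]
      simp only [Finsupp.smul_apply, Finsupp.mapRange_apply, smul_eq_mul]
      rw [mul_assoc, mul_assoc, Algebra.commutes]
    | add x y hx hy => rw [add_mul, map_add, map_add, Finsupp.add_apply, Finsupp.add_apply, hx, hy,
        add_mul]
  refine ⟨⟨fun I => ?_⟩⟩
  by_cases hI : I = ⊥
  · exact Or.inl hI
  right
  have hex : ∃ m, ∃ t ∈ I, t ≠ 0 ∧ (E.repr t).support.card = m := by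
    by_contra hcon
    push Not at hcon
    apply hI
    rw [eq_bot_iff]
    intro t ht
    by_contra h0
    exact hcon _ t ht (fun h => h0 (by rw [h]; exact zero_mem _)) rfl
  obtain ⟨t, htI, ht0, htm⟩ := Nat.find_spec hex
  have hmin : ∀ u ∈ I, (E.repr u).support.card < (E.repr t).support.card → u = 0 := by
    intro u hu hlt
    by_contra h0
    rw [htm] at hlt
    exact Nat.find_min hex hlt ⟨u, hu, h0, rfl⟩
  have hrt : E.repr t ≠ 0 := fun h => ht0 (by simpa using h)
  obtain ⟨i₀, hi₀⟩ := Finsupp.ne_iff.1 hrt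
  have hc0 : E.repr t i₀ ≠ 0 := by simpa using hi₀
  -- normalise one coefficient to `1`
  let s := ((E.repr t i₀)⁻¹ ⊗ₜ[k] (1 : K)) * t
  have hsI : s ∈ I := I.mul_mem_left _ _ htI
  have hs : ∀ i, E.repr s i = (E.repr t i₀)⁻¹ * E.repr t i := hL _ t
  have hs1 : E.repr s i₀ = 1 := by rw [hs, inv_mul_cancel₀ hc0]
  have hcomm : ∀ b : B, (b ⊗ₜ[k] (1 : K)) * s - s * (b ⊗ₜ[k] (1 : K)) = 0 := by
    intro b
    apply hmin _ (I.sub_mem (I.mul_mem_left _ _ hsI) (I.mul_mem_right _ _ hsI))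
    apply Finset.card_lt_card
    rw [Finset.ssubset_iff_of_subset]
    · refine ⟨i₀, by simpa using hc0, ?_⟩
      simp only [map_sub, Finsupp.mem_support_iff, Finsupp.sub_apply, not_not]
      rw [hL, hR, hs1]; simp
    · intro i hi
      simp only [map_sub, Finsupp.mem_support_iff, Finsupp.sub_apply] at hi ⊢
      intro h
      apply hi
      rw [hL, hR, hs, h]; simp
  have hcen : ∀ i, ∃ c : k, algebraMap k B c = E.repr s i := by
    intro i
    have hmem : E.repr s i ∈ Subalgebra.center k B := by
      rw [Subalgebra.mem_center_iff]
      intro b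
      rw [← hL, ← hR, sub_eq_zero.1 (hcomm b)]
    exact Algebra.mem_bot.1 (Algebra.IsCentral.out hmem)
  choose c hc using hcen
  have hsum : s = (1 : B) ⊗ₜ[k] (∑ i ∈ (E.repr s).support, c i • e i) := by
    conv_lhs => rw [← E.linearCombination_repr s, Finsupp.linearCombination_apply, Finsupp.sum]
    rw [TensorProduct.tmul_sum]
    refine Finset.sum_congr rfl fun i _ => ?_
    rw [hE, ← hc, TensorProduct.tmul_smul]
    rw [TensorProduct.smul_tmul', TensorProduct.smul_tmul', smul_eq_mul, mul_one,
      Algebra.smul_def, mul_one]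
  set y : K := ∑ i ∈ (E.repr s).support, c i • e i with hy
  have hy0 : y ≠ 0 := by
    intro h
    have : s = 0 := by rw [hsum, h, TensorProduct.tmul_zero]
    rw [this] at hs1
    simp at hs1
  have h1 : (1 : B ⊗[k] K) ∈ I := by
    have := I.mul_mem_left ((1 : B) ⊗ₜ[k] y⁻¹) _ hsI
    rw [hsum, Algebra.TensorProduct.tmul_mul_tmul, inv_mul_cancel₀ hy0, mul_one] at this
    exact this
  rw [eq_top_iff]
  intro z _
  simpa using I.mul_mem_left z 1 h1

/-- A finite-dimensional central division `k`-algebra is split by the algebraic closure of `k`. -/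
theorem exists_splitting (k B : Type*) [Field k] [DivisionRing B] [Algebra k B]
    [Algebra.IsCentral k B] [FiniteDimensional k B] :
    ∃ n : ℕ, Nonempty (AlgebraicClosure k ⊗[k] B ≃ₐ[AlgebraicClosure k]
      Matrix (Fin n) (Fin n) (AlgebraicClosure k)) := by
  have h := isSimpleRing_tensor k B (AlgebraicClosure k)
  have : IsSimpleRing (AlgebraicClosure k ⊗[k] B) :=
    IsSimpleRing.of_ringEquiv
      (Algebra.TensorProduct.comm k B (AlgebraicClosure k)).toRingEquiv h
  obtain ⟨n, -, hn⟩ := IsSimpleRing.exists_algEquiv_matrix_of_isAlgClosed (AlgebraicClosure k)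
    (AlgebraicClosure k ⊗[k] B)
  exact ⟨n, hn⟩

/-- The reduced trace `Trd_B(x)` of `x ∈ B`: the trace of the matrix of `1 ⊗ x` under an isomorphism
of `k^alg`-algebras `k^alg ⊗[k] B ≃ M_n(k^alg)` (by Skolem–Noether the choice does not matter).
Its value, which always lies in the subfield `k`, is recorded as an element of `k^alg`. -/
noncomputable def reducedTrace (k : Type*) {B : Type*} [Field k] [DivisionRing B] [Algebra k B]
    [Algebra.IsCentral k B] [FiniteDimensional k B] (x : B) : AlgebraicClosure k :=
  Matrix.trace ((exists_splitting k B).choose_spec.some ((1 : AlgebraicClosure k) ⊗ₜ[k] x))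

end Splitting

section Involution

/-- The fixed field `k₀ = k^τ` in `k` of the involution `τ = star` of the `k`-algebra `B`. -/
def fixedField (k B : Type*) [Field k] [DivisionRing B] [Algebra k B] [StarRing B] :
    Subfield k where
  carrier := {c | star (algebraMap k B c) = algebraMap k B c}
  mul_mem' {a b} ha hb := by
    simp only [Set.mem_ofPred_eq] at ha hb ⊢
    rw [map_mul, star_mul, ha, hb, ← map_mul, ← map_mul, mul_comm]
  one_mem' := by simp
  add_mem' {a b} ha hb := by
    simp only [Set.mem_ofPred_eq] at ha hb ⊢
    rw [map_add, star_add, ha, hb]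
  zero_mem' := by simp
  neg_mem' {a} ha := by
    simp only [Set.mem_ofPred_eq] at ha ⊢
    rw [map_neg, star_neg, ha]
  inv_mem' a ha := by
    simp only [Set.mem_ofPred_eq] at ha ⊢
    rw [map_inv₀, star_inv₀, ha]

/-- The involution `τ = star` of `B` is unitary (of the second kind): it is not the identity on the
centre `k`. -/
def IsUnitaryInvolution (k B : Type*) [Field k] [DivisionRing B] [Algebra k B] [StarRing B] :
    Prop :=
  ∃ c : k, star (algebraMap k B c) ≠ algebraMap k B c

/-- `τ = star` is positive at the ordering `P` of `k₀`: the involution trace form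
`x ↦ Trd_B(τ(x) x)`, which has values in `k₀`, is positive definite with respect to `P`. -/
def IsPositiveAt (k B : Type*) [Field k] [DivisionRing B] [Algebra k B] [StarRing B]
    [Algebra.IsCentral k B] [FiniteDimensional k B] (P : RingPreordering (fixedField k B)) :
    Prop :=
  ∀ x : B, x ≠ 0 → ∃ c : fixedField k B, c ∈ P ∧ c ≠ 0 ∧
    algebraMap k (AlgebraicClosure k) (c : k) = reducedTrace k (star x * x)

/-- `L` is a subfield of `B` which contains `k₀` (being a `k₀`-subalgebra) and is contained in the
set `Sym(B, τ) = {x | τ(x) = x}`. -/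
def IsSymmetricSubfield (k B : Type*) [Field k] [DivisionRing B] [Algebra k B] [StarRing B]
    (L : Subalgebra (fixedField k B) B) : Prop :=
  IsField L ∧ ∀ x ∈ L, x ∈ selfAdjoint B

end Involution

/-- The `F`-subalgebra `L` of `A` is a field, and the field extension `L/F` is Galois. -/
def IsGaloisSubfield {F A : Type*} [Field F] [Ring A] [Algebra F A] (L : Subalgebra F A) : Prop :=
  ∃ h : IsField L, letI : Field L := h.toField; IsGalois F L

end DivisionAlgebraWithInvolution

open DivisionAlgebraWithInvolution

/-! Let `S` be the field generated over `k` by `L₀` and `√-d`; it is stable under `τ`. The crux is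
that positivity forces `τ` to commute with every `g` in `Gal(S/k)`. Let `A = τgτg⁻¹`, a
`k`-automorphism of finite order `m`. A trace form invariant under `Gal(S/k)` is positive on each
pair `(Aⁱy, y)`, hence on `(∑_{i<m} Aⁱy, y)`; but for `y = Ax - x` the sum telescopes to `0`, so `A
= 1`. Consequently `Gal(S/k)` acts on the symmetric elements of `S`, which form `L₀` by maximality,
and the elements fixed by this action lie in `k ∩ Sym(B, τ) = k₀`. The invariant form uses the trace
of left multiplication on `B` in place of `Trd_B`: it is a positive integer multiple of `Trd_B`, and
its invariance on `S` follows from viewing `B` as an `S`-vector space. -/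

/-! ### Positivity and automorphisms of a field -/

/-- An involution `τ` of a field `M` commutes with every automorphism of `M/k` as soon as the form
`x ↦ T(τ(x) x)` is positive for some additive function `T` invariant under these automorphisms. -/
theorem algEquiv_comm_of_positive {k M : Type*} [Field k] [Field M] [Algebra k M]
    [Finite (M ≃ₐ[k] M)] (τ : M →+* M) (hτ : ∀ x, τ (τ x) = x)
    (hk : ∀ c : k, ∃ c' : k, τ (algebraMap k M c) = algebraMap k M c')
    {R : Type*} [AddCommMonoid R] (T : M →+ R) (hT : ∀ (g : M ≃ₐ[k] M) x, T (g x) = T x)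
    (Pos : Set R) (hadd : ∀ a b, a ∈ Pos → b ∈ Pos → a + b ∈ Pos) (hzero : (0 : R) ∉ Pos)
    (hpos : ∀ x, x ≠ 0 → T (τ x * x) ∈ Pos) (g : M ≃ₐ[k] M) (x : M) : g (τ x) = τ (g x) := by
  let τe : M ≃+* M := RingEquiv.ofRingHom τ τ (RingHom.ext hτ) (RingHom.ext hτ)
  let A : M ≃ₐ[k] M := AlgEquiv.ofRingEquiv
    (f := (((g.symm : M ≃+* M).trans τe).trans (g : M ≃+* M)).trans τe) (by
      intro c
      obtain ⟨c', hc'⟩ := hk c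
      change τ (g (τ (g.symm (algebraMap k M c)))) = _
      rw [g.symm.commutes, hc', g.commutes, ← hc', hτ])
  have hA : ∀ x, A x = τ (g (τ (g.symm x))) := fun _ => rfl
  have hAτ : ∀ w, τ (A w) = A.symm (τ w) := by
    intro w
    rw [AlgEquiv.eq_symm_apply]
    simp [hA, hτ]
  -- For `i = 1`, `τ(Ay)y = g(τ(z)z)` with `z = g⁻¹y`. Since `τA = A⁻¹τ`, one has `τ(A^(i+2) y)y =
  -- A⁻¹(τ(Aⁱ(Ay))·Ay)`, so invariance of `T` reduces `i + 2` to `i`.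
  have key : ∀ i : ℕ, ∀ y : M, y ≠ 0 → T (τ ((A ^ i) y) * y) ∈ Pos := by
    intro i
    induction i using Nat.twoStepInduction with
    | zero => simpa using hpos
    | one =>
      intro y hy
      have h := hpos (g.symm y) (by simpa using hy)
      rw [← hT g, map_mul, AlgEquiv.apply_symm_apply] at h
      rwa [pow_one, hA, hτ]
    | more i ih _ =>
      intro y hy
      have h := ih (A y) (by simpa using hy)
      rw [← hT A.symm, map_mul, AlgEquiv.symm_apply_apply, ← hAτ] at h
      have e : (A ^ (i + 2)) y = A ((A ^ i) (A y)) := by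
        rw [show i + 2 = 1 + i + 1 by ring, pow_add, pow_add, pow_one]
        rfl
      rwa [e]
  have hA1 : ∀ x, A x = x := by
    intro x
    by_contra hx
    have hy : A x - x ≠ 0 := sub_ne_zero.2 hx
    have hm : 0 < orderOf A := orderOf_pos A
    have hsum : ∑ i ∈ Finset.range (orderOf A), (A ^ i) (A x - x) = 0 := by
      have : ∀ i, (A ^ i) (A x - x) = (A ^ (i + 1)) x - (A ^ i) x := by
        intro i
        rw [map_sub, pow_succ]
        rfl
      simp_rw [this]
      rw [Finset.sum_range_sub (fun i => (A ^ i) x), pow_orderOf_eq_one]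
      simp
    have hmem := Finset.sum_induction_nonempty
      (fun i => T (τ ((A ^ i) (A x - x)) * (A x - x))) (· ∈ Pos) hadd
      (Finset.nonempty_range_iff.2 hm.ne') (fun i _ => key i _ hy)
    rw [← map_sum, ← Finset.sum_mul, ← map_sum, hsum] at hmem
    simp [hzero] at hmem
  have h := hA1 (g x)
  rw [hA, AlgEquiv.symm_apply_apply] at h
  rw [← hτ (g (τ x)), h]

/-! ### Traces of multiplication operators -/

/-- The trace of scalar multiplication by `z ∈ M` on an `M`-vector space is invariant under the
automorphisms of `M/k`. -/
theorem trace_lsmul_algEquiv {k M V : Type*} [Field k] [Field M] [Algebra k M] [AddCommGroup V]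
    [Module k V] [Module M V] [IsScalarTower k M V] (g : M ≃ₐ[k] M) (z : M) :
    LinearMap.trace k V (Algebra.lsmul k k V (g z)) =
      LinearMap.trace k V (Algebra.lsmul k k V z) := by
  let b := Module.Basis.ofVectorSpace M V
  -- Applying `g` to the coordinates is `g`-semilinear over `M`, so it conjugates multiplication by
  -- `z` into multiplication by `g z`.
  let e : V ≃ₗ[k] V := (b.repr.restrictScalars k).trans
    ((Finsupp.mapRange.linearEquiv g.toLinearEquiv).trans (b.repr.restrictScalars k).symm)
  have he : ∀ v, e (z • v) = g z • e v := by
    intro v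
    apply b.repr.injective
    ext i
    simp [e]
  rw [← LinearMap.trace_conj' (Algebra.lsmul k k V z) e]
  congr 1
  ext v
  rw [LinearEquiv.conj_apply_apply]
  simp [he]

/-- The trace of left multiplication by a matrix on `n × n` matrices is `n` times its trace. -/
theorem Matrix.trace_lmul {n K : Type*} [Fintype n] [DecidableEq n] [Field K]
    (X : Matrix n n K) : LinearMap.trace K (Matrix n n K) (Algebra.lmul K _ X) = Fintype.card n * X.trace := by
  rw [LinearMap.trace_eq_matrix_trace K (Matrix.stdBasis K n n),
    Matrix.trace, Fintype.sum_prod_type]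
  simp only [Matrix.diag, LinearMap.toMatrix_apply, Matrix.stdBasis_eq_single, Algebra.coe_lmul_eq_mul,
    LinearMap.mul_apply']
  have : ∀ i j, (Matrix.stdBasis K n n).repr (X * Matrix.single i j 1) (i, j) = X i i := by
    intro i j
    simp [Matrix.stdBasis]
  simp [this, Matrix.trace, Finset.mul_sum]

/-- The trace of left multiplication is a positive integer multiple of the reduced trace. -/
theorem exists_trace_eq_mul_reducedTrace (k B : Type*) [Field k] [DivisionRing B] [Algebra k B]
    [Algebra.IsCentral k B] [FiniteDimensional k B] :
    ∃ n : ℕ, n ≠ 0 ∧ ∀ x : B, algebraMap k (AlgebraicClosure k) (LinearMap.trace k B (Algebra.lmul k B x)) =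
      n * reducedTrace k x := by
  set K := AlgebraicClosure k
  let φ := (exists_splitting k B).choose_spec.some
  refine ⟨(exists_splitting k B).choose, ?_, fun x => ?_⟩
  -- Matrices of size `0` form the zero ring, but the tensor product is nontrivial.
  · intro h0
    have : IsEmpty (Fin (exists_splitting k B).choose) := by rw [h0]; infer_instance
    exact not_subsingleton _ φ.injective.subsingleton
  · have h1 : LinearMap.trace K (K ⊗[k] B) ((Algebra.lmul k B x).baseChange K) =
        algebraMap k K (LinearMap.trace k B (Algebra.lmul k B x)) := LinearMap.trace_baseChange _ _
    rw [← h1, ← LinearMap.trace_conj' _ φ.toLinearEquiv]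
    have h2 := Matrix.trace_lmul (φ ((1 : K) ⊗ₜ[k] x))
    rw [Fintype.card_fin] at h2
    refine Eq.trans ?_ h2
    congr 1
    ext1 v
    rw [LinearEquiv.conj_apply_apply]
    obtain ⟨w, rfl⟩ := φ.surjective v
    have h3 : ((Algebra.lmul k B x).baseChange K) w = ((1 : K) ⊗ₜ[k] x) * w := by
      induction w with
      | zero => simp
      | tmul a b => simp
      | add a b ha hb => rw [map_add, mul_add, ha, hb]
    change φ ((Algebra.lmul k B x).baseChange K (φ.symm (φ w))) = _ * _
    rw [AlgEquiv.symm_apply_apply, h3, map_mul]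

/-! ### The involution on subfields of `B` -/

section Star

variable {k B : Type*} [Field k] [DivisionRing B] [Algebra k B] [StarRing B]

/-- An involution of a central algebra preserves the centre. -/
theorem exists_star_algebraMap [Algebra.IsCentral k B] (c : k) :
    ∃ c' : k, algebraMap k B c' = star (algebraMap k B c) := by
  have h : star (algebraMap k B c) ∈ Subalgebra.center k B := by
    rw [Subalgebra.mem_center_iff]
    intro b
    rw [← star_star b, ← star_mul, ← star_mul, Algebra.commutes]
  exact Algebra.mem_bot.1 (Algebra.IsCentral.out h)

/-- The subalgebra generated by symmetric elements and central elements is stable under the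
involution. -/
theorem star_mem_adjoin [Algebra.IsCentral k B] {s : Set B}
    (hs : ∀ x ∈ s, star x ∈ Algebra.adjoin k s) {x : B} (hx : x ∈ Algebra.adjoin k s) :
    star x ∈ Algebra.adjoin k s := by
  induction hx using Algebra.adjoin_induction with
  | mem x hx => exact hs x hx
  | algebraMap c =>
    obtain ⟨c', hc'⟩ := exists_star_algebraMap (B := B) c
    rw [← hc']
    exact Subalgebra.algebraMap_mem _ _
  | add x y _ _ hx hy => rw [star_add]; exact add_mem hx hy
  | mul x y _ _ hx hy => rw [star_mul]; exact mul_mem hy hx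

/-- The involution restricted to a stable subfield. -/
def starSubfield (S : Subalgebra k B) (hS : IsField S) (hstar : ∀ x ∈ S, star x ∈ S) : S →+* S where
  toFun x := ⟨star (x : B), hstar x x.2⟩
  map_one' := Subtype.ext (by simp)
  map_zero' := Subtype.ext (by simp)
  map_add' x y := Subtype.ext (by simp)
  map_mul' x y := by
    rw [hS.mul_comm x y]
    exact Subtype.ext (by simp)

/-- The symmetric elements of a subfield of `B` over `k`, as a subalgebra over `k₀`. -/
def symmetricPart (S : Subalgebra k B) (hS : IsField S) : Subalgebra (fixedField k B) B where
  carrier := {x | x ∈ S ∧ star x = x}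
  mul_mem' {a b} ha hb := ⟨mul_mem ha.1 hb.1, by
    rw [star_mul, ha.2, hb.2]
    exact congrArg Subtype.val (hS.mul_comm ⟨b, hb.1⟩ ⟨a, ha.1⟩)⟩
  add_mem' {a b} ha hb := ⟨add_mem ha.1 hb.1, by rw [star_add, ha.2, hb.2]⟩
  algebraMap_mem' c := ⟨S.algebraMap_mem c, c.2⟩

/-- Inverses stay symmetric because `star` commutes with inversion. This makes the symmetric part a
competitor in the maximality of `L₀`. -/
theorem isSymmetricSubfield_symmetricPart (S : Subalgebra k B) (hS : IsField S) :
    IsSymmetricSubfield k B (symmetricPart S hS) := by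
  refine ⟨⟨exists_pair_ne _, fun a b => Subtype.ext ?_, fun {a} ha => ?_⟩, fun x hx => hx.2⟩
  · exact (congrArg Subtype.val (hS.mul_comm ⟨a, a.2.1⟩ ⟨b, b.2.1⟩) :)
  · have ha' : (a : B) ≠ 0 := fun h => ha (Subtype.ext h)
    obtain ⟨b, hb⟩ := hS.mul_inv_cancel (a := ⟨a, a.2.1⟩) (fun h => ha' (congrArg Subtype.val h))
    have hb' : (a : B) * b = 1 := congrArg Subtype.val hb
    have hinv : (b : B) = (a : B)⁻¹ := eq_inv_of_mul_eq_one_right hb'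
    exact ⟨⟨b, b.2, by rw [hinv, star_inv₀, a.2.2]⟩, Subtype.ext hb'⟩

/-- If a stable subfield `S` of `B` is Galois over `k` and the involution commutes with the
automorphisms of `S/k`, then the field of symmetric elements of `S` is Galois over `k₀`. -/
theorem isGaloisSubfield_symmetricPart [FiniteDimensional (fixedField k B) B]
    [FiniteDimensional k B] (S : Subalgebra k B) (hS : IsField S)
    (hGal : letI := hS.toField; IsGalois k S)
    (hcomm : ∀ (g : S ≃ₐ[k] S) (x : S), star (x : B) = x → star (g x : B) = g x) :
    IsGaloisSubfield (symmetricPart S hS) := by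
  let L := symmetricPart S hS
  have hLf : IsField L := (isSymmetricSubfield_symmetricPart S hS).1
  refine ⟨hLf, ?_⟩
  let _ : Field S := hS.toField
  let _ : Field L := hLf.toField
  have : IsGalois k S := hGal
  let res : (S ≃ₐ[k] S) → L → L := fun g x => ⟨g ⟨x, x.2.1⟩, (g ⟨x, x.2.1⟩).2, hcomm g _ x.2.2⟩
  let G : (S ≃ₐ[k] S) → (L ≃ₐ[fixedField k B] L) := fun g =>
    { toFun := res g
      invFun := res g.symm
      left_inv := fun x => Subtype.ext (congrArg Subtype.val (g.symm_apply_apply ⟨x, x.2.1⟩) :)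
      right_inv := fun x => Subtype.ext (congrArg Subtype.val (g.apply_symm_apply ⟨x, x.2.1⟩) :)
      map_mul' := fun x y => Subtype.ext
        (congrArg Subtype.val (map_mul g ⟨x, x.2.1⟩ ⟨y, y.2.1⟩) :)
      map_add' := fun x y => Subtype.ext
        (congrArg Subtype.val (map_add g ⟨x, x.2.1⟩ ⟨y, y.2.1⟩) :)
      commutes' := fun c => Subtype.ext (congrArg Subtype.val (g.commutes c) :) }
  have : FiniteDimensional (fixedField k B) L := inferInstance
  -- The restrictions `G g` already suffice: an element they all fix lies in `k` as `S/k` is Galois,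
  -- and being symmetric it lies in `k₀`.
  apply IsGalois.of_fixedField_eq_bot
  rw [eq_bot_iff]
  intro x hx
  have hfix : ∀ g : S ≃ₐ[k] S, g ⟨x, x.2.1⟩ = ⟨x, x.2.1⟩ := by
    intro g
    have h : G g x = x := hx ⟨G g, trivial⟩
    exact Subtype.ext (congrArg Subtype.val h :)
  obtain ⟨c, hc⟩ := (IsGalois.mem_bot_iff_fixed (F := k) (⟨x, x.2.1⟩ : S)).2 hfix
  have hc' : algebraMap k B c = x := congrArg Subtype.val hc
  refine ⟨⟨c, ?_⟩, Subtype.ext hc'⟩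
  change star (algebraMap k B c) = algebraMap k B c
  rw [hc']
  exact x.2.2

/-- If the involution is positive at `P`, then it commutes with the automorphisms of every stable
subfield of `B` over `k`. -/
theorem algEquiv_star_comm_of_isPositiveAt [Algebra.IsCentral k B] [FiniteDimensional k B]
    {P : RingPreordering (fixedField k B)} (hP : IsPositiveAt k B P)
    (S : Subalgebra k B) (hS : IsField S) (hstar : ∀ x ∈ S, star x ∈ S)
    (g : S ≃ₐ[k] S) (x : S) : g (starSubfield S hS hstar x) = starSubfield S hS hstar (g x) := by
  let _ : Field S := hS.toField
  obtain ⟨n, hn, hT⟩ := exists_trace_eq_mul_reducedTrace k B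
  let Pos : Set k := {c | ∃ a : fixedField k B, a ∈ P ∧ a ≠ 0 ∧ (a : k) = c}
  have hadd : ∀ a b, a ∈ Pos → b ∈ Pos → a + b ∈ Pos := by
    rintro _ _ ⟨a, haP, ha, rfl⟩ ⟨b, hbP, hb, rfl⟩
    refine ⟨a + b, add_mem haP hbP, fun h => ha ?_, by simp⟩
    -- If `a + b = 0`, then `-a = b` is in `P` too.
    refine P.eq_zero_of_mem_of_neg_mem haP ?_
    rwa [neg_eq_of_add_eq_zero_right h]
  refine algEquiv_comm_of_positive (k := k) (starSubfield S hS hstar)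
    (fun x => Subtype.ext (star_star (x : B))) (fun c => ?_)
    (T := ((LinearMap.trace k B).comp
      ((Algebra.lmul k B).toLinearMap.comp S.val.toLinearMap)).toAddMonoidHom)
    (fun g x => trace_lsmul_algEquiv (V := B) g x) Pos hadd ?_ ?_ g x
  · obtain ⟨c', hc'⟩ := exists_star_algebraMap (B := B) c
    exact ⟨c', Subtype.ext hc'.symm⟩
  · rintro ⟨a, -, ha, h0⟩
    exact ha (Subtype.ext h0)
  · intro x hx
    have hx' : (x : B) ≠ 0 := fun h => hx (Subtype.ext h)
    obtain ⟨c, hcP, hc, hcT⟩ := hP x hx'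
    have h : LinearMap.trace k B (Algebra.lmul k B (star (x : B) * x)) = n • (c : k) := by
      apply (algebraMap k (AlgebraicClosure k)).injective
      rw [hT, ← hcT, nsmul_eq_mul, map_mul, map_natCast]
    change LinearMap.trace k B (Algebra.lmul k B (star (x : B) * x)) ∈ Pos
    rw [h]
    clear h hT
    -- A sum of `n ≥ 1` copies of a positive element is positive.
    induction n, Nat.one_le_iff_ne_zero.2 hn using Nat.le_induction with
    | base => exact ⟨c, hcP, hc, (one_nsmul _).symm⟩
    | succ m hm ih =>
      rw [succ_nsmul]
      exact hadd _ _ (ih (by omega)) ⟨c, hcP, hc, rfl⟩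

end Star

theorem proposition2p3 {k B : Type*} [Field k] (hchar : ringChar k ≠ 2)
    [DivisionRing B] [Algebra k B] [Algebra.IsCentral k B] [FiniteDimensional k B]
    -- the involution `τ = star` on `B`
    [StarRing B] (hτ : IsUnitaryInvolution k B)
    -- `d ∈ k₀` with `k = k₀(√-d)`, where `r = √-d`
    (d : fixedField k B) (r : k) (hr : r ^ 2 = -(d : k))
    (hk : IntermediateField.adjoin (fixedField k B) {r} = ⊤)
    (L₀ : Subalgebra (fixedField k B) B) (hL₀ : Maximal (IsSymmetricSubfield k B) L₀)
    (hL : IsGaloisSubfield (Algebra.adjoin k ((L₀ : Set B) ∪ {algebraMap k B r})))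
    (P : RingPreordering (fixedField k B)) [P.IsOrdering] (hP : IsPositiveAt k B P) :
    IsGaloisSubfield L₀ := by
  obtain ⟨hS, hGal⟩ := hL
  set S := Algebra.adjoin k ((L₀ : Set B) ∪ {algebraMap k B r}) with hSdef
  have hstar : ∀ x ∈ S, star x ∈ S := by
    refine fun x hx => star_mem_adjoin ?_ hx
    rintro y (hy | rfl)
    · rw [show star y = y from hL₀.prop.2 y hy]
      exact Algebra.subset_adjoin (Or.inl hy)
    · obtain ⟨c', hc'⟩ := exists_star_algebraMap (B := B) r
      rw [← hc']
      exact Subalgebra.algebraMap_mem _ _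
  -- As `r² = -d` lies in `k₀`, `k/k₀` is finite, hence so is `B` over `k₀`.
  have hint : IsIntegral (fixedField k B) r :=
    IsIntegral.of_pow two_pos (hr ▸ (isIntegral_algebraMap (x := d)).neg)
  have : FiniteDimensional (fixedField k B) k := by
    have h := IntermediateField.adjoin.finiteDimensional hint
    rw [hk] at h
    exact Module.Finite.equiv (IntermediateField.topEquiv (F := fixedField k B)
      (E := k)).toLinearEquiv
  have : FiniteDimensional (fixedField k B) B := FiniteDimensional.trans (fixedField k B) k B
  have hsub : L₀ ≤ symmetricPart S hS := fun x hx =>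
    ⟨Algebra.subset_adjoin (Or.inl hx), hL₀.prop.2 x hx⟩
  rw [hL₀.eq_of_le (isSymmetricSubfield_symmetricPart S hS) hsub]
  refine isGaloisSubfield_symmetricPart S hS hGal fun g x hx => ?_
  have h := algEquiv_star_comm_of_isPositiveAt hP S hS hstar g x
  rw [show starSubfield S hS hstar x = x from Subtype.ext hx] at h
  exact (congrArg Subtype.val h).symm
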